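/- Norm inequality template. Let $\|\cdot\|$ be a unitarily invariant norm defined for complex square matrices of all sizes, i.e. a norm on every $\mathcal M_d=\mathbb C^{d\times d}$ such that $\|UAV\|=\|A\|$ for all unitaries $U,V$, and $\|A\oplus 0\|=\|A\|$ whenever $A$ is bordered by zero rows and columns. Let $\|X\|^*:=\sup\{|\mathrm{tr}(XY)| : Y\in\mathcal M_d,\ \|Y\|\le 1\}$ for $X\in\mathcal M_d$ be the dual norm, and for a real vector $x$ of any length let $\phi^*(x):=\|\mathrm{diag}(x)\|^*$ be the corresponding symmetric gauge function. Let $\|\cdot\|_1$ be the trace norm, i.e. the sum of the singular values, and $(x)_+:=\max\{x,0\}$. Let $M\in\mathcal M_{d_1}\otimes\cdots\otimes\mathcal M_{d_n}$ have rank $r$ and partial traces $M_i\in\mathcal M_{d_i}$, $i=1,\dots,n$, where $M_i$ is obtained from $M$ by tracing out all tensor factors except the $i$-th. Then for every real $c\ge 0$ $$\sum_{i=1}^n \|M_i\|\;\le\; c\,\|M\|_1+\kappa(c)\,\|M\|,\qquad \kappa(c):=\sup\,\phi^*(\Lambda_1,\dots,\Lambda_r)<\infty .$$ Here the supremum is taken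 over all $n$-tuples of vectors $\lambda^{(i)}\in\mathbb R_+^{d_i}$ with $\phi^*(\lambda^{(i)})\le 1$, $i=1,\dots,n$, and $\Lambda_1\ge\Lambda_2\ge\cdots$ are the $\prod_{i=1}^n d_i$ numbers $\big(-c+\sum_{i=1}^n\lambda^{(i)}_{j_i}\big)_+$, one for each multi-index $(j_1,\dots,j_n)$ with $j_i\in\{1,\dots,d_i\}$, in decreasing order; only the $r$ largest are used. -/

import Mathlib

/-- A unitarily invariant norm, defined for complex square matrices of all sizes: a norm on every
`Matrix (Fin d) (Fin d) ℂ`, invariant under multiplication by unitaries from either side, whose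
values do not change when a matrix is bordered by zero rows and columns. -/
structure UnitarilyInvariantNorm where
  /-- The norm on `d × d` matrices. -/
  toSeminorm : ∀ d : ℕ, Seminorm ℂ (Matrix (Fin d) (Fin d) ℂ)
  eq_zero_of_toSeminorm_eq_zero :
    ∀ (d : ℕ) (A : Matrix (Fin d) (Fin d) ℂ), toSeminorm d A = 0 → A = 0
  unitary_mul_mul_unitary :
    ∀ (d : ℕ) (U V A : Matrix (Fin d) (Fin d) ℂ),
      U ∈ Matrix.unitaryGroup (Fin d) ℂ → V ∈ Matrix.unitaryGroup (Fin d) ℂ →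
        toSeminorm d (U * A * V) = toSeminorm d A
  zero_padding :
    ∀ (d k : ℕ) (A : Matrix (Fin d) (Fin d) ℂ),
      toSeminorm (d + k)
        (Matrix.reindex finSumFinEquiv finSumFinEquiv
          (Matrix.fromBlocks A 0 0 (0 : Matrix (Fin k) (Fin k) ℂ))) = toSeminorm d A

namespace UnitarilyInvariantNorm

/-- The dual norm `‖X‖* = sup {|tr (X Y)| : ‖Y‖ ≤ 1}`. -/
noncomputable def dualNorm (N : UnitarilyInvariantNorm) {d : ℕ}
    (X : Matrix (Fin d) (Fin d) ℂ) : ℝ :=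
  sSup {t : ℝ | ∃ Y : Matrix (Fin d) (Fin d) ℂ,
    N.toSeminorm d Y ≤ 1 ∧ t = ‖Matrix.trace (X * Y)‖}

/-- The symmetric gauge function `φ*` that corresponds to the dual norm: its value at `x` is the
dual norm of the diagonal matrix with diagonal `x`. -/
noncomputable def dualGauge (N : UnitarilyInvariantNorm) {d : ℕ} (x : Fin d → ℝ) : ℝ :=
  N.dualNorm (Matrix.diagonal fun k => (x k : ℂ))

end UnitarilyInvariantNorm

/-- The trace norm of a matrix: the sum of its singular values. -/
noncomputable def traceNorm {ι : Type*} [Fintype ι] [DecidableEq ι] (M : Matrix ι ι ℂ) : ℝ :=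
  ∑ k ∈ Finset.range (Fintype.card ι), (Matrix.toEuclideanLin M).singularValues k

/-- The partial trace onto the `i`-th factor: all tensor factors except the `i`-th one are traced
out. The `(a, b)` entry is the sum of `M x y` over all pairs of multi-indices `x`, `y` that agree
outside `i` and have `x i = a`, `y i = b`. -/
def partialTrace {n : ℕ} {d : Fin n → ℕ}
    (M : Matrix (∀ i, Fin (d i)) (∀ i, Fin (d i)) ℂ) (i : Fin n) :
    Matrix (Fin (d i)) (Fin (d i)) ℂ :=
  Matrix.of fun a b =>
    ∑ x : (∀ j, Fin (d j)) with x i = a, M x (Function.update x i b)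

/-- The components of a finite real family in decreasing order, with multiplicity, counted from
`0` (and continued by zeros past the end). -/
noncomputable def decreasing {ι : Type*} [Fintype ι] (f : ι → ℝ) (k : ℕ) : ℝ :=
  ((Finset.univ.val.map f).sort (· ≥ ·)).getD k 0

/-- The family of all `(-c + ∑ i, λ⁽ⁱ⁾_{jᵢ})₊`, indexed by the multi-indices `j`. -/
noncomputable def shiftedSum {n : ℕ} {d : Fin n → ℕ} (c : ℝ) (lam : ∀ i, Fin (d i) → ℝ)
    (j : ∀ i, Fin (d i)) : ℝ :=
  max (-c + ∑ i, lam i (j i)) 0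

namespace UnitarilyInvariantNorm

/-- The values `φ*(Λ₁, …, Λᵣ)` over which the supremum `κ(c)` is taken. -/
def kappaSet (N : UnitarilyInvariantNorm) {n : ℕ} (d : Fin n → ℕ) (r : ℕ) (c : ℝ) : Set ℝ :=
  {t : ℝ | ∃ lam : ∀ i, Fin (d i) → ℝ,
    (∀ i k, 0 ≤ lam i k) ∧ (∀ i, N.dualGauge (lam i) ≤ 1) ∧
      t = N.dualGauge fun k : Fin r => decreasing (shiftedSum c lam) k}

/-- `κ(c)`, the supremum of `φ*(Λ₁, …, Λᵣ)`. -/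
noncomputable def kappa (N : UnitarilyInvariantNorm) {n : ℕ} (d : Fin n → ℕ) (r : ℕ)
    (c : ℝ) : ℝ :=
  sSup (N.kappaSet d r c)

/-- The norm of a matrix on a tensor product with factors of dimensions `d i`. -/
noncomputable def tensorNorm (N : UnitarilyInvariantNorm) {n : ℕ} {d : Fin n → ℕ}
    (M : Matrix (∀ i, Fin (d i)) (∀ i, Fin (d i)) ℂ) : ℝ :=
  N.toSeminorm (∏ i, d i) (Matrix.reindex finPiFinEquiv finPiFinEquiv M)

end UnitarilyInvariantNorm

/-!
The inequality is dual to a statement about sums of commuting local operators. By Hahn–Banach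
(`UnitarilyInvariantNorm.exists_trace_mul_eq`), `‖Mᵢ‖ = tr (Mᵢ Yᵢ)` with `‖Yᵢ‖* ≤ 1`, and
`tr (Mᵢ Yᵢ) = tr (M (1 ⊗ ⋯ ⊗ Yᵢ ⊗ ⋯ ⊗ 1))` (`trace_partialTrace_mul`). Singular value decompositions
`Yᵢ = Fᵢ diag(λ⁽ⁱ⁾) Gᵢᴴ` and `M = U diag(s) Vᴴ` are used throughout; `φ*(λ⁽ⁱ⁾) = ‖Yᵢ‖* ≤ 1`.

The `Yᵢ` need not be Hermitian, so their embeddings need not be diagonal in a common basis. The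
Cauchy–Schwarz inequality repairs this: it bounds the real part of `⟨v, Fᵢ diag(λ⁽ⁱ⁾) Gᵢᴴ u⟩`
by the mean of the quadratic forms of `Fᵢ diag(λ⁽ⁱ⁾) Fᵢᴴ` at `v` and of `Gᵢ diag(λ⁽ⁱ⁾) Gᵢᴴ` at `u`
(`re_trace_partialTrace_mul_le`). The embeddings of the former are diagonal, simultaneously for all
`i`, in the product basis given by `⨂ Fᵢ`, and those of the latter in the one given by `⨂ Gᵢ`.

In such a basis the sum of the forms at the singular vectors is `∑ k, s k * ∑ j, p j k * μ j`, where
`μ j = ∑ i, λ⁽ⁱ⁾ (j i)` and `p` consists of the squared moduli of the entries of a unitary matrix,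
so that it is doubly stochastic. From `μ ≤ c + (μ - c)₊` one gets the term `c ‖M‖₁` and the sum
`∑ k, s k * ∑ j, p j k * (μ j - c)₊`. By Birkhoff's theorem and the rearrangement inequality
(`sum_mul_doublyStochastic_le`) the latter is at most the sum of the `s k * Λ k` with both sequences
decreasing. As `s k` vanishes from the rank `r` on, this is `tr (diag s · diag (Λ₁, …, Λᵣ))`, which
is at most `φ*(Λ₁, …, Λᵣ) ‖M‖` (`UnitarilyInvariantNorm.sum_mul_le_dualGauge_mul`).

The supremum `κ(c)` is finite because the norm controls every matrix entry: the projection onto a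
coordinate is an average of two unitaries (`UnitarilyInvariantNorm.norm_apply_le`).
-/

/-! ### Duality for unitarily invariant norms -/

namespace UnitarilyInvariantNorm

variable (N : UnitarilyInvariantNorm) {d : ℕ}

/-- The projection onto a coordinate is the average of the identity and a unitary. -/
theorem _root_.Matrix.exists_unitary_single_eq {d : ℕ} (a : Fin d) :
    ∃ R ∈ Matrix.unitaryGroup (Fin d) ℂ, Matrix.single a a 1 = (1 / 2 : ℂ) • (1 + R) := by
  refine ⟨Matrix.diagonal fun k => if k = a then 1 else -1, ?_, ?_⟩
  · rw [Matrix.mem_unitaryGroup_iff, Matrix.star_eq_conjTranspose,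
      Matrix.diagonal_conjTranspose, Matrix.diagonal_mul_diagonal, ← Matrix.diagonal_one]
    congr 1
    ext k
    by_cases h : k = a <;> simp [h]
  · ext i j
    by_cases hij : i = j
    · subst hij
      by_cases h : i = a
      · subst h
        simp
        norm_num
      · simp [h, Ne.symm h]
    · have : ¬ (a = i ∧ a = j) := fun h => hij (h.1 ▸ h.2)
      simp [hij, this]

/-- Cutting a matrix down to one row does not increase the norm. -/
theorem toSeminorm_single_mul_le (a : Fin d) (Y : Matrix (Fin d) (Fin d) ℂ) :
    N.toSeminorm d (Matrix.single a a 1 * Y) ≤ N.toSeminorm d Y := by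
  obtain ⟨R, hR, hs⟩ := Matrix.exists_unitary_single_eq a
  have hRY : N.toSeminorm d (R * Y) = N.toSeminorm d Y := by
    simpa using N.unitary_mul_mul_unitary d R 1 Y hR (one_mem _)
  rw [hs, Matrix.smul_mul, map_smul_eq_mul, Matrix.add_mul, Matrix.one_mul]
  have := map_add_le_add (N.toSeminorm d) Y (R * Y)
  rw [hRY] at this
  norm_num
  linarith

/-- Cutting a matrix down to one column does not increase the norm. -/
theorem toSeminorm_mul_single_le (b : Fin d) (Y : Matrix (Fin d) (Fin d) ℂ) :
    N.toSeminorm d (Y * Matrix.single b b 1) ≤ N.toSeminorm d Y := by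
  obtain ⟨R, hR, hs⟩ := Matrix.exists_unitary_single_eq b
  have hYR : N.toSeminorm d (Y * R) = N.toSeminorm d Y := by
    simpa using N.unitary_mul_mul_unitary d 1 R Y (one_mem _) hR
  rw [hs, Matrix.mul_smul, map_smul_eq_mul, Matrix.mul_add, Matrix.mul_one]
  have := map_add_le_add (N.toSeminorm d) Y (Y * R)
  rw [hYR] at this
  norm_num
  linarith

theorem toSeminorm_mul_conjTranspose {U V : Matrix (Fin d) (Fin d) ℂ}
    (hU : U ∈ Matrix.unitaryGroup (Fin d) ℂ) (hV : V ∈ Matrix.unitaryGroup (Fin d) ℂ)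
    (A : Matrix (Fin d) (Fin d) ℂ) :
    N.toSeminorm d (U * A * V.conjTranspose) = N.toSeminorm d A :=
  N.unitary_mul_mul_unitary d U _ A hU (Unitary.star_mem hV)

theorem toSeminorm_single_pos (a b : Fin d) : 0 < N.toSeminorm d (Matrix.single a b 1) := by
  refine lt_of_le_of_ne (apply_nonneg _ _) fun h => ?_
  have := congrFun (congrFun (N.eq_zero_of_toSeminorm_eq_zero d _ h.symm) a) b
  simp at this

/-- Every matrix entry is controlled by the norm. -/
theorem norm_apply_le (Y : Matrix (Fin d) (Fin d) ℂ) (a b : Fin d) :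
    ‖Y a b‖ ≤ (N.toSeminorm d (Matrix.single a b 1))⁻¹ * N.toSeminorm d Y := by
  rw [inv_mul_eq_div, le_div_iff₀ (N.toSeminorm_single_pos a b), ← map_smul_eq_mul]
  have : Y a b • Matrix.single a b (1 : ℂ) = Matrix.single a a 1 * Y * Matrix.single b b 1 := by
    rw [Matrix.single_mul_mul_single]
    simp
  rw [this]
  exact (N.toSeminorm_mul_single_le _ _).trans (N.toSeminorm_single_mul_le _ _)

theorem norm_trace_mul_le_sum {X Y : Matrix (Fin d) (Fin d) ℂ} (hY : N.toSeminorm d Y ≤ 1) :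
    ‖Matrix.trace (X * Y)‖ ≤
      ∑ a, ∑ b, ‖X a b‖ * (N.toSeminorm d (Matrix.single b a 1))⁻¹ := by
  simp only [Matrix.trace, Matrix.diag_apply, Matrix.mul_apply]
  refine (norm_sum_le _ _).trans (Finset.sum_le_sum fun a _ => (norm_sum_le _ _).trans
    (Finset.sum_le_sum fun b _ => ?_))
  rw [norm_mul]
  gcongr
  refine (N.norm_apply_le Y b a).trans (mul_le_of_le_one_right ?_ hY)
  exact inv_nonneg.2 (apply_nonneg _ _)

/-- The supremum that defines the dual norm is a genuine one. -/
theorem bddAbove_dualNorm (X : Matrix (Fin d) (Fin d) ℂ) :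
    BddAbove {t : ℝ | ∃ Y : Matrix (Fin d) (Fin d) ℂ,
      N.toSeminorm d Y ≤ 1 ∧ t = ‖Matrix.trace (X * Y)‖} := by
  refine ⟨∑ a, ∑ b, ‖X a b‖ * (N.toSeminorm d (Matrix.single b a 1))⁻¹, ?_⟩
  rintro _ ⟨Y, hY, rfl⟩
  exact N.norm_trace_mul_le_sum hY

theorem dualNorm_le {X : Matrix (Fin d) (Fin d) ℂ} {C : ℝ} (hC : 0 ≤ C)
    (h : ∀ Y, N.toSeminorm d Y ≤ 1 → ‖Matrix.trace (X * Y)‖ ≤ C) : N.dualNorm X ≤ C := by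
  refine Real.sSup_le ?_ hC
  rintro _ ⟨Y, hY, rfl⟩
  exact h Y hY

/-- Hölder's inequality for the norm and its dual. -/
theorem norm_trace_mul_le (X Y : Matrix (Fin d) (Fin d) ℂ) :
    ‖Matrix.trace (X * Y)‖ ≤ N.dualNorm X * N.toSeminorm d Y := by
  rcases (apply_nonneg (N.toSeminorm d) Y).eq_or_lt with h | h
  · rw [N.eq_zero_of_toSeminorm_eq_zero d Y h.symm]
    simp
  · rw [← div_le_iff₀ h]
    refine le_csSup (N.bddAbove_dualNorm X)
      ⟨(((N.toSeminorm d Y)⁻¹ : ℝ) : ℂ) • Y, ?_, ?_⟩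
    · rw [map_smul_eq_mul, Complex.norm_real, Real.norm_of_nonneg (by positivity),
        inv_mul_cancel₀ h.ne']
    · rw [Matrix.mul_smul, Matrix.trace_smul, norm_smul, Complex.norm_real,
        Real.norm_of_nonneg (by positivity), inv_mul_eq_div]

/-- Every component of a vector is controlled by its dual gauge. -/
theorem abs_le_dualGauge_mul (x : Fin d → ℝ) (k : Fin d) :
    |x k| ≤ N.dualGauge x * N.toSeminorm d (Matrix.single k k 1) := by
  have := N.norm_trace_mul_le (Matrix.diagonal fun k => (x k : ℂ)) (Matrix.single k k 1)
  simpa [dualGauge, Matrix.trace, Matrix.diagonal_mul, Matrix.single_apply, ← ite_and] using this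

theorem dualGauge_le_sum (x : Fin d → ℝ) :
    N.dualGauge x ≤ ∑ k, |x k| * (N.toSeminorm d (Matrix.single k k 1))⁻¹ := by
  have hC : 0 ≤ ∑ k, |x k| * (N.toSeminorm d (Matrix.single k k 1))⁻¹ :=
    Finset.sum_nonneg fun k _ => mul_nonneg (abs_nonneg _) (inv_nonneg.2 (apply_nonneg _ _))
  refine N.dualNorm_le hC fun Y hY => (N.norm_trace_mul_le_sum hY).trans_eq ?_
  refine Finset.sum_congr rfl fun a _ => ?_
  rw [Finset.sum_eq_single a (fun b _ hb => by simp [Matrix.diagonal_apply_ne' _ hb]) (by simp)]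
  simp

/-- Duality: by the Hahn–Banach theorem the norm of `A` is attained at a functional of the form
`tr (· Y)`, which is bounded by the norm. -/
theorem exists_trace_mul_eq (A : Matrix (Fin d) (Fin d) ℂ) :
    ∃ Y : Matrix (Fin d) (Fin d) ℂ, Matrix.trace (A * Y) = N.toSeminorm d A ∧
      ∀ Z, ‖Matrix.trace (Z * Y)‖ ≤ N.toSeminorm d Z := by
  rcases eq_or_ne A 0 with rfl | hA
  · exact ⟨0, by simp, by simp⟩
  obtain ⟨g, hg, hgle⟩ := Module.Dual.exists_extension_of_le_seminorm (ℂ ∙ A)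
    ((N.toSeminorm d A : ℂ) • (LinearEquiv.coord ℂ _ A hA : _ →ₗ[ℂ] ℂ))
    (p := N.toSeminorm d) (by
      rintro ⟨x, hx⟩
      obtain ⟨t, rfl⟩ := Submodule.mem_span_singleton.1 hx
      have : LinearEquiv.coord ℂ _ A hA ⟨t • A, hx⟩ = t :=
        smul_left_injective ℂ hA (LinearEquiv.coord_apply_smul ℂ _ A hA ⟨t • A, hx⟩)
      simp [this, map_smul_eq_mul, mul_comm, abs_of_nonneg])
  have hgA : g A = N.toSeminorm d A := by
    have := hg ⟨A, Submodule.mem_span_singleton_self A⟩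
    simpa [LinearEquiv.coord_self] using this
  -- every linear functional on matrices is of the form `tr (· Y)`
  have key : ∀ Z : Matrix (Fin d) (Fin d) ℂ,
      Matrix.trace (Z * Matrix.of fun a b => g (Matrix.single b a 1)) = g Z := by
    intro Z
    conv_rhs => rw [Matrix.matrix_eq_sum_single Z]
    simp only [map_sum, Matrix.trace, Matrix.diag_apply, Matrix.mul_apply, Matrix.of_apply]
    refine Finset.sum_congr rfl fun a _ => Finset.sum_congr rfl fun b _ => ?_
    rw [← smul_eq_mul, ← map_smul, Matrix.smul_single]
    simp
  exact ⟨_, (key A).trans hgA, fun Z => by rw [key]; exact hgle Z⟩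

end UnitarilyInvariantNorm

/-! ### Singular value decomposition -/

open Module in
/-- The singular value decomposition of a square matrix; the singular values are arranged along the
diagonal by an enumeration `e` of the index type. -/
theorem exists_singular_value_decomposition {ι : Type*} [Fintype ι] [DecidableEq ι] {m : ℕ}
    (e : ι ≃ Fin m) (M : Matrix ι ι ℂ) :
    ∃ U ∈ Matrix.unitaryGroup ι ℂ, ∃ V ∈ Matrix.unitaryGroup ι ℂ,
      M = U * Matrix.diagonal (fun x => ((Matrix.toEuclideanLin M).singularValues (e x) : ℂ)) *
        V.conjTranspose := by
  set T := Matrix.toEuclideanLin M with hT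
  set s : ι → ℝ := fun x => T.singularValues (e x) with hs
  have hm : finrank ℂ (EuclideanSpace ℂ ι) = m := by
    simp [Fintype.card_congr e]
  set v : OrthonormalBasis ι ℂ (EuclideanSpace ℂ ι) :=
    (T.isSymmetric_adjoint_comp_self.eigenvectorBasis hm).reindex e.symm with hv
  have hTv : ∀ j, (LinearMap.adjoint T) (T (v j)) = ((s j ^ 2 : ℝ) : ℂ) • v j := by
    intro j
    have := T.isSymmetric_adjoint_comp_self.apply_eigenvectorBasis hm (e j)
    rw [← T.sq_singularValues_fin hm] at this
    rw [LinearMap.comp_apply] at this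
    simpa [hv, hs] using this
  have hinner : ∀ j k, inner ℂ (T (v j)) (T (v k)) = if j = k then ((s k ^ 2 : ℝ) : ℂ) else 0 := by
    intro j k
    rw [← LinearMap.adjoint_inner_right, hTv, inner_smul_right,
      orthonormal_iff_ite.1 v.orthonormal j k]
    split_ifs <;> simp
  set S : Set ι := {k | s k ≠ 0}
  -- the left singular vectors that belong to nonzero singular values, extended to a basis
  have hortho : Orthonormal ℂ (S.domRestrict fun k => ((s k)⁻¹ : ℂ) • T (v k)) := by
    rw [orthonormal_iff_ite]
    rintro ⟨j, hj⟩ ⟨k, hk⟩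
    simp only [Set.domRestrict_apply, inner_smul_left, inner_smul_right, hinner, Subtype.mk.injEq]
    have hk' : (s k : ℂ) ≠ 0 := by exact_mod_cast hk
    split_ifs with h
    · subst h
      simp
      field_simp
    · simp
  obtain ⟨u, hu⟩ := hortho.exists_orthonormalBasis_extension_of_card_eq (by simp)
  have hTu : ∀ k, T (v k) = (s k : ℂ) • u k := by
    intro k
    by_cases hk : s k = 0
    · have : inner ℂ (T (v k)) (T (v k)) = 0 := by rw [hinner]; simp [hk]
      rw [inner_self_eq_zero.1 this]
      simp [hk]
    · rw [hu k hk, smul_smul, mul_inv_cancel₀ (by exact_mod_cast hk), one_smul]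
  have hmem := fun b : OrthonormalBasis ι ℂ (EuclideanSpace ℂ ι) =>
    (EuclideanSpace.basisFun ι ℂ).toMatrix_orthonormalBasis_mem_unitary b
  refine ⟨_, hmem u, _, hmem v, ?_⟩
  set U := (EuclideanSpace.basisFun ι ℂ).toBasis.toMatrix u
  set V := (EuclideanSpace.basisFun ι ℂ).toBasis.toMatrix v
  have hMV : M * V = U * Matrix.diagonal fun x => (s x : ℂ) := by
    ext x k
    have h1 := congrArg (fun w : EuclideanSpace ℂ ι => w x) (hTu k)
    have hVk : V = Matrix.of fun a b => v b a := by
      ext a b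
      simp [V, Basis.toMatrix_apply]
    have hUk : U = Matrix.of fun a b => u b a := by
      ext a b
      simp [U, Basis.toMatrix_apply]
    rw [Matrix.mul_diagonal, hVk, hUk]
    simpa [hT, Matrix.toLpLin_apply, Matrix.mulVec, dotProduct, Matrix.mul_apply,
      mul_comm] using h1
  rw [← hMV, Matrix.mul_assoc, ← Matrix.star_eq_conjTranspose,
    Matrix.mem_unitaryGroup_iff.1 (hmem v), Matrix.mul_one]

/-! ### Local operators and partial traces -/

section LocalOperators

variable {n : ℕ} {d : Fin n → ℕ}

/-- The operator `1 ⊗ ⋯ ⊗ A ⊗ ⋯ ⊗ 1` that acts as `A` on the `i`-th tensor factor. -/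
def localOperator (i : Fin n) (A : Matrix (Fin (d i)) (Fin (d i)) ℂ) :
    Matrix (∀ i, Fin (d i)) (∀ i, Fin (d i)) ℂ :=
  Matrix.of fun x y => if Function.update x i (y i) = y then A (x i) (y i) else 0

/-- The tensor product `F₁ ⊗ ⋯ ⊗ Fₙ`. -/
def tensorProduct (F : ∀ i, Matrix (Fin (d i)) (Fin (d i)) ℂ) :
    Matrix (∀ i, Fin (d i)) (∀ i, Fin (d i)) ℂ :=
  Matrix.of fun x y => ∏ i, F i (x i) (y i)

theorem sum_localOperator_mul (i : Fin n) (A : Matrix (Fin (d i)) (Fin (d i)) ℂ)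
    (x : ∀ i, Fin (d i)) (g : (∀ i, Fin (d i)) → ℂ) :
    ∑ y, localOperator i A x y * g y = ∑ b, A (x i) b * g (Function.update x i b) := by
  simp only [localOperator, Matrix.of_apply, ite_mul, zero_mul]
  rw [← Finset.sum_filter]
  refine Finset.sum_nbij' (fun y => y i) (fun b => Function.update x i b) ?_ ?_ ?_ ?_ ?_
  · simp
  · simp
  · simp
  · simp
  · intro y hy
    rw [(Finset.mem_filter.1 hy).2]

theorem localOperator_transpose_apply (i : Fin n) (A : Matrix (Fin (d i)) (Fin (d i)) ℂ)
    (x y : ∀ i, Fin (d i)) : localOperator i A.transpose x y = localOperator i A y x := by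
  have h : ∀ x y : ∀ i, Fin (d i),
      Function.update x i (y i) = y → Function.update y i (x i) = x := by
    intro x y h
    rw [← h]
    simp
  simp only [localOperator, Matrix.of_apply, Matrix.transpose_apply]
  exact if_congr ⟨h x y, h y x⟩ rfl rfl

theorem sum_mul_localOperator (i : Fin n) (A : Matrix (Fin (d i)) (Fin (d i)) ℂ)
    (y : ∀ i, Fin (d i)) (g : (∀ i, Fin (d i)) → ℂ) :
    ∑ x, g x * localOperator i A x y = ∑ b, g (Function.update y i b) * A b (y i) := by
  simp only [← localOperator_transpose_apply i A y, mul_comm (g _), sum_localOperator_mul,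
    Matrix.transpose_apply]

theorem localOperator_conjTranspose (i : Fin n) (A : Matrix (Fin (d i)) (Fin (d i)) ℂ) :
    localOperator i A.conjTranspose = (localOperator i A).conjTranspose := by
  ext x y
  rw [Matrix.conjTranspose_apply, ← localOperator_transpose_apply]
  simp only [localOperator, Matrix.of_apply, Matrix.transpose_apply, Matrix.conjTranspose_apply]
  split_ifs <;> simp

theorem localOperator_mul (i : Fin n) (A B : Matrix (Fin (d i)) (Fin (d i)) ℂ) :
    localOperator i (A * B) = localOperator i A * localOperator i B := by
  ext x z
  rw [Matrix.mul_apply, sum_localOperator_mul]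
  simp only [localOperator, Matrix.of_apply, Function.update_idem, Function.update_self]
  split_ifs
  · rw [Matrix.mul_apply]
  · simp

theorem localOperator_diagonal (i : Fin n) (w : Fin (d i) → ℂ) :
    localOperator i (Matrix.diagonal w) = Matrix.diagonal fun x => w (x i) := by
  ext x y
  by_cases hxy : x = y
  · subst hxy
    simp [localOperator]
  · rw [Matrix.diagonal_apply_ne _ hxy]
    simp only [localOperator, Matrix.of_apply]
    split_ifs with h
    · refine Matrix.diagonal_apply_ne _ fun h' => hxy ?_
      rw [← h, ← h', Function.update_eq_self]
    · rfl

/-- The partial trace is the adjoint of the embedding of an operator into the tensor product. -/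
theorem trace_partialTrace_mul (M : Matrix (∀ i, Fin (d i)) (∀ i, Fin (d i)) ℂ) (i : Fin n)
    (Y : Matrix (Fin (d i)) (Fin (d i)) ℂ) :
    Matrix.trace (partialTrace M i * Y) = Matrix.trace (M * localOperator i Y) := by
  simp only [Matrix.trace, Matrix.diag_apply, Matrix.mul_apply, sum_mul_localOperator]
  simp only [partialTrace, Matrix.of_apply]
  rw [← Finset.sum_fiberwise Finset.univ (fun x : ∀ i, Fin (d i) => x i)]
  refine Finset.sum_congr rfl fun a _ => ?_
  simp only [Finset.sum_mul]
  rw [Finset.sum_comm]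
  refine Finset.sum_congr rfl fun x hx => Finset.sum_congr rfl fun b _ => ?_
  rw [(Finset.mem_filter.1 hx).2]

theorem tensorProduct_mem_unitaryGroup {F : ∀ i, Matrix (Fin (d i)) (Fin (d i)) ℂ}
    (hF : ∀ i, F i ∈ Matrix.unitaryGroup (Fin (d i)) ℂ) :
    tensorProduct F ∈ Matrix.unitaryGroup (∀ i, Fin (d i)) ℂ := by
  rw [Matrix.mem_unitaryGroup_iff]
  ext x z
  simp only [Matrix.mul_apply, Matrix.star_eq_conjTranspose, Matrix.conjTranspose_apply,
    tensorProduct, Matrix.of_apply, star_prod, ← Finset.prod_mul_distrib]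
  rw [← Fintype.prod_sum fun i b => F i (x i) b * star (F i (z i) b)]
  have : ∀ i, ∑ b, F i (x i) b * star (F i (z i) b) = if x i = z i then 1 else 0 := by
    intro i
    rw [← Matrix.one_apply, ← Matrix.mem_unitaryGroup_iff.1 (hF i)]
    simp [Matrix.mul_apply, Matrix.star_apply]
  simp only [this, Matrix.one_apply, Finset.prod_ite_zero, Finset.prod_const_one, funext_iff,
    Finset.mem_univ, forall_true_left]

theorem tensorProduct_update (F : ∀ i, Matrix (Fin (d i)) (Fin (d i)) ℂ) (i : Fin n)
    (x y : ∀ i, Fin (d i)) (b : Fin (d i)) :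
    tensorProduct F (Function.update x i b) y =
      F i b (y i) * ∏ j ∈ Finset.univ.erase i, F j (x j) (y j) := by
  rw [tensorProduct, Matrix.of_apply, ← Finset.mul_prod_erase _ _ (Finset.mem_univ i),
    Function.update_self]
  congr 1
  refine Finset.prod_congr rfl fun j hj => ?_
  rw [Function.update_of_ne (Finset.ne_of_mem_erase hj)]

theorem tensorProduct_update_right (F : ∀ i, Matrix (Fin (d i)) (Fin (d i)) ℂ) (i : Fin n)
    (x y : ∀ i, Fin (d i)) (b : Fin (d i)) :
    tensorProduct F x (Function.update y i b) =
      F i (x i) b * ∏ j ∈ Finset.univ.erase i, F j (x j) (y j) := by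
  rw [tensorProduct, Matrix.of_apply, ← Finset.mul_prod_erase _ _ (Finset.mem_univ i),
    Function.update_self]
  congr 1
  refine Finset.prod_congr rfl fun j hj => ?_
  rw [Function.update_of_ne (Finset.ne_of_mem_erase hj)]

theorem localOperator_mul_tensorProduct {F : ∀ i, Matrix (Fin (d i)) (Fin (d i)) ℂ} {i : Fin n}
    {A B : Matrix (Fin (d i)) (Fin (d i)) ℂ} (h : A * F i = F i * B) :
    localOperator i A * tensorProduct F = tensorProduct F * localOperator i B := by
  ext x z
  rw [Matrix.mul_apply, Matrix.mul_apply, sum_localOperator_mul, sum_mul_localOperator]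
  simp only [tensorProduct_update, tensorProduct_update_right]
  have := congrFun (congrFun h (x i)) (z i)
  simp only [Matrix.mul_apply] at this
  simp only [mul_right_comm _ (∏ j ∈ Finset.univ.erase i, F j (x j) (z j)), ← mul_assoc,
    ← Finset.sum_mul, this]

end LocalOperators

/-! ### Decreasing rearrangements and doubly stochastic matrices -/

/-- A finite family is a reordering of its components in decreasing order. -/
theorem exists_equiv_decreasing {ι : Type*} [Fintype ι] {m : ℕ} (e : ι ≃ Fin m) (f : ι → ℝ) :
    ∃ e' : ι ≃ Fin m, ∀ j, f j = decreasing f (e' j) := by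
  set g : Fin m → ℝ := fun k => -f (e.symm k) with hg
  set τ := Tuple.sort g
  set T : Fin m → ℝ := fun k => f (e.symm (τ k)) with hTdef
  have hT : Antitone T := fun a b hab => neg_le_neg_iff.1 (Tuple.monotone_sort g hab)
  have hsort : (Finset.univ.val.map f).sort (· ≥ ·) = List.ofFn T := by
    refine List.Perm.eq_of_pairwise (le := (· ≥ ·)) ?_ (Multiset.pairwise_sort _ _) ?_ ?_
    · intro a b _ _ h1 h2
      exact le_antisymm h2 h1
    · rw [List.pairwise_ofFn]
      exact fun i j hij => hT hij.le
    · rw [← Multiset.coe_eq_coe, Multiset.sort_eq, ← Fin.univ_val_map,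
        ← Multiset.map_univ_val_equiv (τ.trans e.symm), Multiset.map_map]
      rfl
  refine ⟨e.trans τ.symm, fun j => ?_⟩
  rw [decreasing, hsort]
  simp [hTdef]

theorem decreasing_antitone {ι : Type*} [Fintype ι] (f : ι → ℝ) {j k : ℕ} (hjk : j ≤ k)
    (hk : k < Fintype.card ι) : decreasing f k ≤ decreasing f j := by
  have hl : ((Finset.univ.val.map f).sort (· ≥ ·)).length = Fintype.card ι := by
    simp
  have hp := Multiset.pairwise_sort (Finset.univ.val.map f) (· ≥ ·)
  rw [decreasing, decreasing, List.getD_eq_getElem _ _ (hl ▸ hk),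
    List.getD_eq_getElem _ _ (hl ▸ hjk.trans_lt hk)]
  rcases hjk.eq_or_lt with rfl | h
  · rfl
  · exact List.pairwise_iff_getElem.1 hp _ _ _ _ h

theorem abs_decreasing_le {ι : Type*} [Fintype ι] {f : ι → ℝ} {C : ℝ} (hC : 0 ≤ C)
    (hf : ∀ j, |f j| ≤ C) (k : ℕ) : |decreasing f k| ≤ C := by
  rw [decreasing]
  by_cases hk : k < ((Finset.univ.val.map f).sort (· ≥ ·)).length
  · rw [List.getD_eq_getElem _ _ hk]
    have := List.getElem_mem hk
    rw [Multiset.mem_sort, Multiset.mem_map] at this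
    obtain ⟨j, -, hj⟩ := this
    rw [← hj]
    exact hf j
  · rw [List.getD_eq_default _ _ (not_lt.1 hk)]
    simpa using hC

/-- A doubly stochastic mixture of `f` pairs with a decreasing sequence at most as well as the
decreasing rearrangement of `f` does: by Birkhoff's theorem it suffices to consider permutations,
for which this is the rearrangement inequality. -/
theorem sum_mul_doublyStochastic_le {ι : Type*} [Fintype ι] [DecidableEq ι] {m : ℕ}
    (e : ι ≃ Fin m) {a : ℕ → ℝ} (ha : Antitone a) (f : ι → ℝ) {p : Matrix ι ι ℝ}
    (hp : p ∈ doublyStochastic ℝ ι) :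
    ∑ k, a (e k) * ∑ j, f j * p j k ≤ ∑ k : Fin m, a k * decreasing f k := by
  obtain ⟨e', he'⟩ := exists_equiv_decreasing e f
  obtain ⟨w, hw, hw1, rfl⟩ := exists_eq_sum_perm_of_mem_doublyStochastic hp
  have hperm : ∀ σ : Equiv.Perm ι, ∑ k, a (e k) * ∑ j, f j * σ.permMatrix ℝ j k ≤
      ∑ k : Fin m, a k * decreasing f k := by
    intro σ
    have h1 : ∑ k, a (e k) * ∑ j, f j * σ.permMatrix ℝ j k = ∑ j, a (e (σ j)) * f j := by
      simp only [Finset.mul_sum]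
      rw [Finset.sum_comm]
      simp [Equiv.toPEquiv_apply, PEquiv.toMatrix_apply, eq_comm]
    have hmono : Monovary (fun k : Fin m => a k) (fun k : Fin m => decreasing f k) := by
      refine Antitone.monovary (fun i j hij => ha hij) fun i j hij => decreasing_antitone f hij ?_
      rw [Fintype.card_congr e, Fintype.card_fin]
      exact j.2
    rw [h1, ← e'.symm.sum_comp]
    refine le_trans (le_of_eq ?_)
      (hmono.sum_comp_perm_mul_le_sum_mul (σ := (e'.symm.trans σ).trans e))
    refine Finset.sum_congr rfl fun k _ => ?_
    rw [he' (e'.symm k)]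
    simp
  calc ∑ k, a (e k) * ∑ j, f j * (∑ σ, w σ • σ.permMatrix ℝ) j k
      = ∑ σ, w σ * ∑ k, a (e k) * ∑ j, f j * σ.permMatrix ℝ j k := by
        simp only [Matrix.sum_apply, Matrix.smul_apply, smul_eq_mul, Finset.mul_sum]
        symm
        rw [Finset.sum_comm]
        refine Finset.sum_congr rfl fun k _ => ?_
        rw [Finset.sum_comm]
        exact Finset.sum_congr rfl fun j _ => Finset.sum_congr rfl fun σ _ => by ring
    _ ≤ ∑ σ, w σ * ∑ k : Fin m, a k * decreasing f k :=
        Finset.sum_le_sum fun σ _ => mul_le_mul_of_nonneg_left (hperm σ) (hw σ)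
    _ = _ := by rw [← Finset.sum_mul, hw1, one_mul]

/-- The squared moduli of the entries of a unitary matrix form a doubly stochastic matrix. -/
theorem normSq_mem_doublyStochastic {ι : Type*} [Fintype ι] [DecidableEq ι] {W : Matrix ι ι ℂ}
    (hW : W ∈ Matrix.unitaryGroup ι ℂ) :
    (Matrix.of fun j k => ‖W j k‖ ^ 2) ∈ doublyStochastic ℝ ι := by
  rw [mem_doublyStochastic_iff_sum]
  refine ⟨fun j k => by simp, fun j => ?_, fun k => ?_⟩
  · have := congrFun (congrFun (Matrix.mem_unitaryGroup_iff.1 hW) j) j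
    simp only [Matrix.mul_apply, Matrix.star_apply, Matrix.one_apply_eq, RCLike.star_def,
      Complex.mul_conj'] at this
    simpa using mod_cast this
  · have := congrFun (congrFun (Matrix.mem_unitaryGroup_iff'.1 hW) k) k
    simp only [Matrix.mul_apply, Matrix.star_apply, Matrix.one_apply_eq, RCLike.star_def,
      Complex.conj_mul'] at this
    simpa using mod_cast this

/-! ### Singular vectors in a product basis -/

/-- The Cauchy–Schwarz and the arithmetic-geometric inequality for the semidefinite form given by
`w`. -/
theorem re_conjTranspose_mul_diagonal_mul_le {ι : Type*} [Fintype ι] [DecidableEq ι]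
    (P Q : Matrix ι ι ℂ) {w : ι → ℝ} (hw : ∀ j, 0 ≤ w j) (k : ι) :
    ((P.conjTranspose * Matrix.diagonal (fun j => (w j : ℂ)) * Q) k k).re ≤
      (∑ j, w j * ‖P j k‖ ^ 2 + ∑ j, w j * ‖Q j k‖ ^ 2) / 2 := by
  rw [Matrix.mul_apply, Complex.re_sum, ← Finset.sum_add_distrib, Finset.sum_div]
  refine Finset.sum_le_sum fun j _ => ?_
  rw [Matrix.mul_diagonal, Matrix.conjTranspose_apply]
  refine (Complex.re_le_norm _).trans ?_
  rw [norm_mul, norm_mul, norm_star, Complex.norm_real, Real.norm_of_nonneg (hw j)]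
  nlinarith [mul_nonneg (hw j) (sq_nonneg (‖P j k‖ - ‖Q j k‖))]

theorem conjTranspose_mul_diagonal_mul_self_apply {ι : Type*} [Fintype ι] [DecidableEq ι]
    (P : Matrix ι ι ℂ) (w : ι → ℝ) (k : ι) :
    (P.conjTranspose * Matrix.diagonal (fun j => (w j : ℂ)) * P) k k =
      ((∑ j, w j * ‖P j k‖ ^ 2 : ℝ) : ℂ) := by
  rw [Matrix.mul_apply]
  push_cast
  refine Finset.sum_congr rfl fun j _ => ?_
  rw [Matrix.mul_diagonal, Matrix.conjTranspose_apply, ← Complex.conj_mul']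
  simp only [RCLike.star_def]
  ring

section TensorProductBasis

variable {n : ℕ} {d : Fin n → ℕ}

/-- The tensor product of the unitaries `F i` diagonalizes every `F i * D * (F i)ᴴ`, embedded into
the `i`-th factor, so the quadratic form of the latter may be computed in the product basis. -/
theorem sum_localOperator_eq_sum_tensorProduct {F : ∀ i, Matrix (Fin (d i)) (Fin (d i)) ℂ}
    (hF : ∀ i, F i ∈ Matrix.unitaryGroup (Fin (d i)) ℂ) (i : Fin n) (lam : Fin (d i) → ℝ)
    (V : Matrix (∀ i, Fin (d i)) (∀ i, Fin (d i)) ℂ) (k : ∀ i, Fin (d i)) :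
    ∑ j, lam (j i) * ‖(localOperator i (F i).conjTranspose * V) j k‖ ^ 2 =
      ∑ j, lam (j i) * ‖((tensorProduct F).conjTranspose * V) j k‖ ^ 2 := by
  set D := Matrix.diagonal (fun b => (lam b : ℂ))
  have hE := tensorProduct_mem_unitaryGroup hF
  set E := tensorProduct F
  have h1 : localOperator i (F i * D * (F i).conjTranspose) * E = E * localOperator i D := by
    refine localOperator_mul_tensorProduct ?_
    rw [Matrix.mul_assoc, ← Matrix.star_eq_conjTranspose, Matrix.mem_unitaryGroup_iff'.1 (hF i),
      Matrix.mul_one]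
  have h2 : localOperator i (F i * D * (F i).conjTranspose) =
      E * localOperator i D * E.conjTranspose := by
    rw [← h1, Matrix.mul_assoc (localOperator _ _), ← Matrix.star_eq_conjTranspose E,
      Matrix.mem_unitaryGroup_iff.1 hE, Matrix.mul_one]
  have hD : localOperator i D = Matrix.diagonal fun j => ((lam (j i) : ℝ) : ℂ) :=
    localOperator_diagonal i _
  have key : (localOperator i (F i).conjTranspose * V).conjTranspose *
        Matrix.diagonal (fun j => ((lam (j i) : ℝ) : ℂ)) *
        (localOperator i (F i).conjTranspose * V) =
      (E.conjTranspose * V).conjTranspose * Matrix.diagonal (fun j => ((lam (j i) : ℝ) : ℂ)) *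
        (E.conjTranspose * V) := by
    rw [← hD]
    calc _ = V.conjTranspose * (localOperator i (F i * D * (F i).conjTranspose)) * V := by
          simp only [localOperator_mul, localOperator_conjTranspose, Matrix.conjTranspose_mul,
            Matrix.conjTranspose_conjTranspose, Matrix.mul_assoc]
      _ = _ := by
          rw [h2]
          simp only [Matrix.conjTranspose_mul, Matrix.conjTranspose_conjTranspose,
            Matrix.mul_assoc]
  have := congrFun (congrFun key k) k
  rw [conjTranspose_mul_diagonal_mul_self_apply _ (fun j : ∀ i, Fin (d i) => lam (j i)),
    conjTranspose_mul_diagonal_mul_self_apply _ (fun j : ∀ i, Fin (d i) => lam (j i))] at this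
  exact_mod_cast this

/-- Pairing a partial trace of `M = U diag(s) Vᴴ` with `F i * diag(lam) * (G i)ᴴ` separates into the
contributions of the right and of the left singular vectors of `M`, each of them computed in a
product basis. -/
theorem re_trace_partialTrace_mul_le {U V : Matrix (∀ i, Fin (d i)) (∀ i, Fin (d i)) ℂ}
    {s : (∀ i, Fin (d i)) → ℝ} (hs : ∀ k, 0 ≤ s k)
    {F G : ∀ i, Matrix (Fin (d i)) (Fin (d i)) ℂ}
    (hF : ∀ i, F i ∈ Matrix.unitaryGroup (Fin (d i)) ℂ)
    (hG : ∀ i, G i ∈ Matrix.unitaryGroup (Fin (d i)) ℂ) (i : Fin n) {lam : Fin (d i) → ℝ}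
    (hlam : ∀ b, 0 ≤ lam b) :
    (Matrix.trace (partialTrace (U * Matrix.diagonal (fun k => (s k : ℂ)) * V.conjTranspose) i *
        (F i * Matrix.diagonal (fun b => (lam b : ℂ)) * (G i).conjTranspose))).re ≤
      (∑ k, s k * ∑ j, lam (j i) * ‖((tensorProduct F).conjTranspose * V) j k‖ ^ 2 +
        ∑ k, s k * ∑ j, lam (j i) * ‖((tensorProduct G).conjTranspose * U) j k‖ ^ 2) / 2 := by
  have hD : localOperator i (Matrix.diagonal (fun b => (lam b : ℂ))) =
      Matrix.diagonal fun j => ((lam (j i) : ℝ) : ℂ) := localOperator_diagonal i _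
  have h1 : Matrix.trace (partialTrace
        (U * Matrix.diagonal (fun k => (s k : ℂ)) * V.conjTranspose) i *
        (F i * Matrix.diagonal (fun b => (lam b : ℂ)) * (G i).conjTranspose)) =
      Matrix.trace (Matrix.diagonal (fun k => (s k : ℂ)) *
        ((localOperator i (F i).conjTranspose * V).conjTranspose *
          Matrix.diagonal (fun j => ((lam (j i) : ℝ) : ℂ)) *
          (localOperator i (G i).conjTranspose * U))) := by
    rw [trace_partialTrace_mul, localOperator_mul, localOperator_mul, hD, Matrix.mul_assoc,
      Matrix.mul_assoc, Matrix.trace_mul_comm]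
    simp only [Matrix.conjTranspose_mul, localOperator_conjTranspose,
      Matrix.conjTranspose_conjTranspose, Matrix.mul_assoc]
  rw [h1, Matrix.trace, Complex.re_sum, ← Finset.sum_add_distrib, Finset.sum_div]
  refine Finset.sum_le_sum fun k _ => ?_
  rw [Matrix.diag_apply, Matrix.diagonal_mul, Complex.re_ofReal_mul, ← mul_add, mul_div_assoc]
  refine mul_le_mul_of_nonneg_left ?_ (hs k)
  refine (re_conjTranspose_mul_diagonal_mul_le _ _
    (w := fun j : ∀ i, Fin (d i) => lam (j i)) (fun j => hlam _) k).trans_eq ?_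
  rw [sum_localOperator_eq_sum_tensorProduct hF, sum_localOperator_eq_sum_tensorProduct hG]

/-- Splitting `∑ i, lam i (j i)` into at most `c` and the excess over `c`. -/
theorem sum_mul_sum_le_add {s : (∀ i, Fin (d i)) → ℝ} (hs : ∀ k, 0 ≤ s k)
    {p : Matrix (∀ i, Fin (d i)) (∀ i, Fin (d i)) ℝ} (hp : p ∈ doublyStochastic ℝ (∀ i, Fin (d i)))
    (c : ℝ) (lam : ∀ i, Fin (d i) → ℝ) :
    ∑ i, ∑ k, s k * ∑ j, lam i (j i) * p j k ≤
      c * ∑ k, s k + ∑ k, s k * ∑ j, shiftedSum c lam j * p j k := by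
  rw [Finset.sum_comm, Finset.mul_sum, ← Finset.sum_add_distrib]
  refine Finset.sum_le_sum fun k _ => ?_
  rw [← Finset.mul_sum, mul_comm c, ← mul_add]
  refine mul_le_mul_of_nonneg_left ?_ (hs k)
  rw [Finset.sum_comm]
  have : c = ∑ j, c * p j k := by
    rw [← Finset.mul_sum, sum_col_of_mem_doublyStochastic hp, mul_one]
  refine le_trans ?_ (add_le_add_left this.ge _)
  rw [← Finset.sum_add_distrib]
  refine Finset.sum_le_sum fun j _ => ?_
  rw [← Finset.sum_mul, ← add_mul]
  refine mul_le_mul_of_nonneg_right ?_ (nonneg_of_mem_doublyStochastic hp)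
  have := le_max_left (-c + ∑ i, lam i (j i)) 0
  rw [shiftedSum]
  linarith

end TensorProductBasis

/-! ### Norms of partial traces -/

namespace UnitarilyInvariantNorm

variable (N : UnitarilyInvariantNorm)

/-- `κ(c)` is finite: a bound on the dual gauges bounds all components of the `λ⁽ⁱ⁾`, hence the
`Λ k`, and therefore the dual gauge of `(Λ₁, …, Λᵣ)`. -/
theorem bddAbove_kappaSet {n : ℕ} (d : Fin n → ℕ) (r : ℕ) (c : ℝ) :
    BddAbove (N.kappaSet d r c) := by
  set B : ∀ i, Fin (d i) → ℝ := fun i k => N.toSeminorm (d i) (Matrix.single k k 1) with hB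
  have hB0 : ∀ i k, 0 ≤ B i k := fun i k => apply_nonneg _ _
  set C : ℝ := |c| + ∑ i, ∑ k, B i k with hC
  have hBs : 0 ≤ ∑ i, ∑ k, B i k :=
    Finset.sum_nonneg fun i _ => Finset.sum_nonneg fun k _ => hB0 i k
  have hC0 : 0 ≤ C := add_nonneg (abs_nonneg _) hBs
  refine ⟨∑ k : Fin r, C * (N.toSeminorm r (Matrix.single k k 1))⁻¹, ?_⟩
  rintro _ ⟨lam, -, hlam1, rfl⟩
  have hlam : ∀ i k, lam i k ≤ ∑ k, B i k := by
    intro i k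
    have h1 := N.abs_le_dualGauge_mul (lam i) k
    have h2 : N.dualGauge (lam i) * B i k ≤ B i k := mul_le_of_le_one_left (hB0 i k) (hlam1 i)
    exact (le_abs_self _).trans <| h1.trans <| h2.trans <|
      Finset.single_le_sum (f := B i) (fun k _ => hB0 i k) (Finset.mem_univ k)
  have hS : ∀ j, |shiftedSum c lam j| ≤ C := by
    intro j
    rw [shiftedSum, abs_of_nonneg (le_max_right _ _)]
    refine max_le ?_ hC0
    have := Finset.sum_le_sum fun i (_ : i ∈ Finset.univ) => hlam i (j i)
    have := neg_le_abs c
    linarith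
  refine (N.dualGauge_le_sum _).trans (Finset.sum_le_sum fun k _ => ?_)
  exact mul_le_mul_of_nonneg_right (abs_decreasing_le hC0 hS k) (inv_nonneg.2 (apply_nonneg _ _))

/-- The norm of `A` is the pairing with a matrix `F diag(lam) Gᴴ` whose singular values `lam` have
dual gauge at most one. -/
theorem exists_dual_singular_values {d : ℕ} (A : Matrix (Fin d) (Fin d) ℂ) :
    ∃ F ∈ Matrix.unitaryGroup (Fin d) ℂ, ∃ G ∈ Matrix.unitaryGroup (Fin d) ℂ,
      ∃ lam : Fin d → ℝ, (∀ k, 0 ≤ lam k) ∧ N.dualGauge lam ≤ 1 ∧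
        Matrix.trace (A * (F * Matrix.diagonal (fun k => (lam k : ℂ)) * G.conjTranspose)) =
          N.toSeminorm d A := by
  obtain ⟨Y, hAY, hY⟩ := N.exists_trace_mul_eq A
  obtain ⟨F, hF, G, hG, h⟩ := exists_singular_value_decomposition (Equiv.refl (Fin d)) Y
  set lam : Fin d → ℝ := fun k => (Matrix.toEuclideanLin Y).singularValues k
  refine ⟨F, hF, G, hG, lam, fun k => LinearMap.singularValues_nonneg _ _, ?_, ?_⟩
  · refine N.dualNorm_le zero_le_one fun Z hZ => ?_
    have hD : Matrix.diagonal (fun k => (lam k : ℂ)) = F.conjTranspose * Y * G := by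
      rw [h]
      simp only [← Matrix.star_eq_conjTranspose, Matrix.mul_assoc,
        Matrix.mem_unitaryGroup_iff'.1 hG, Matrix.mul_one]
      rw [← Matrix.mul_assoc, Matrix.mem_unitaryGroup_iff'.1 hF, Matrix.one_mul]
      rfl
    have : Matrix.trace (F.conjTranspose * Y * G * Z) =
        Matrix.trace (G * Z * F.conjTranspose * Y) := by
      rw [Matrix.mul_assoc, Matrix.trace_mul_comm]
      simp only [Matrix.mul_assoc]
    rw [hD, this]
    refine (hY _).trans ?_
    rwa [N.toSeminorm_mul_conjTranspose hG hF]
  · rw [← hAY]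
    conv_rhs => rw [h]
    rfl

/-- A diagonal matrix whose entries vanish from the `r`-th on pairs with a sequence `t` by Hölder's
inequality for the norm and its dual, and only the first `r` entries of `t` matter. -/
theorem sum_mul_le_dualGauge_mul {m r : ℕ} (hrm : r ≤ m) {a : ℕ → ℝ} (ha : ∀ k, r ≤ k → a k = 0)
    (t : ℕ → ℝ) :
    ∑ k : Fin m, a k * t k ≤ N.dualGauge (fun k : Fin r => t k) *
      N.toSeminorm m (Matrix.diagonal fun k : Fin m => (a k : ℂ)) := by
  obtain ⟨q, rfl⟩ := Nat.exists_eq_add_of_le hrm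
  have hpad : Matrix.diagonal (fun k : Fin (r + q) => (a k : ℂ)) =
      Matrix.reindex finSumFinEquiv finSumFinEquiv
        (Matrix.fromBlocks (Matrix.diagonal fun k : Fin r => (a k : ℂ)) 0 0
          (0 : Matrix (Fin q) (Fin q) ℂ)) := by
    have h0 : (0 : Matrix (Fin q) (Fin q) ℂ) = Matrix.diagonal fun _ => 0 := by simp
    rw [h0, Matrix.fromBlocks_diagonal, Matrix.reindex_apply, Matrix.submatrix_diagonal_equiv]
    congr 1
    ext k
    refine Fin.addCases (fun k => ?_) (fun k => ?_) k
    · simp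
    · simp [ha (r + k) (Nat.le_add_right _ _)]
  have h := N.norm_trace_mul_le (Matrix.diagonal fun k : Fin r => (t k : ℂ))
    (Matrix.diagonal fun k : Fin r => (a k : ℂ))
  rw [hpad, N.zero_padding, Fin.sum_univ_add]
  simp only [Fin.val_castAdd, Fin.val_natAdd, ha _ (Nat.le_add_right _ _), zero_mul,
    Finset.sum_const_zero, add_zero]
  refine le_trans ?_ h
  rw [Matrix.diagonal_mul_diagonal, Matrix.trace_diagonal]
  refine le_trans (le_of_eq ?_) (Complex.re_le_norm _)
  rw [Complex.re_sum]
  refine Finset.sum_congr rfl fun k _ => ?_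
  rw [← Complex.ofReal_mul, Complex.ofReal_re, mul_comm]

/-- The norm depends on the singular values only. -/
theorem tensorNorm_mul_diagonal_mul {n : ℕ} {d : Fin n → ℕ}
    {U V : Matrix (∀ i, Fin (d i)) (∀ i, Fin (d i)) ℂ}
    (hU : U ∈ Matrix.unitaryGroup (∀ i, Fin (d i)) ℂ)
    (hV : V ∈ Matrix.unitaryGroup (∀ i, Fin (d i)) ℂ) (a : ℕ → ℝ) :
    N.tensorNorm
        (U * Matrix.diagonal (fun x => (a (finPiFinEquiv x) : ℂ)) * V.conjTranspose) =
      N.toSeminorm (∏ i, d i) (Matrix.diagonal fun k => (a k : ℂ)) := by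
  set e : (∀ i, Fin (d i)) ≃ Fin (∏ i, d i) := finPiFinEquiv
  have hmem : ∀ W ∈ Matrix.unitaryGroup (∀ i, Fin (d i)) ℂ,
      W.submatrix e.symm e.symm ∈ Matrix.unitaryGroup (Fin (∏ i, d i)) ℂ := by
    intro W hW
    rw [Matrix.mem_unitaryGroup_iff, Matrix.star_eq_conjTranspose, Matrix.conjTranspose_submatrix,
      Matrix.submatrix_mul_equiv, ← Matrix.star_eq_conjTranspose, Matrix.mem_unitaryGroup_iff.1 hW,
      Matrix.submatrix_one_equiv]
  rw [← N.toSeminorm_mul_conjTranspose (hmem U hU) (hmem V hV)]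
  have : Matrix.diagonal (fun k : Fin (∏ i, d i) => (a k : ℂ)) =
      (Matrix.diagonal (fun x => (a (e x) : ℂ))).submatrix e.symm e.symm := by
    rw [Matrix.submatrix_diagonal_equiv]
    congr 1
    ext k
    simp
  rw [tensorNorm, this, Matrix.conjTranspose_submatrix, Matrix.submatrix_mul_equiv,
    Matrix.submatrix_mul_equiv, Matrix.reindex_apply]

end UnitarilyInvariantNorm

theorem mainTheorem2 (N : UnitarilyInvariantNorm) (n : ℕ) (d : Fin n → ℕ)
    (M : Matrix (∀ i, Fin (d i)) (∀ i, Fin (d i)) ℂ) (r : ℕ) (hr : M.rank = r)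
    (c : ℝ) (hc : 0 ≤ c) :
    BddAbove (N.kappaSet d r c) ∧
      ∑ i, N.toSeminorm (d i) (partialTrace M i) ≤
        c * traceNorm M + N.kappa d r c * N.tensorNorm M := by
  have hbdd := N.bddAbove_kappaSet d r c
  refine ⟨hbdd, ?_⟩
  set e : (∀ i, Fin (d i)) ≃ Fin (∏ i, d i) := finPiFinEquiv with he
  obtain ⟨U, hU, V, hV, hM⟩ := exists_singular_value_decomposition e M
  have hnorm := N.tensorNorm_mul_diagonal_mul hU hV (Matrix.toEuclideanLin M).singularValues
  rw [← he, ← hM] at hnorm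
  choose F hF G hG lam hlam hgauge hdual using
    fun i => N.exists_dual_singular_values (partialTrace M i)
  set a : ℕ → ℝ := ⇑(Matrix.toEuclideanLin M).singularValues with ha
  have ha0 : ∀ k, 0 ≤ a k := (Matrix.toEuclideanLin M).singularValues_nonneg
  have hanti : Antitone a := (Matrix.toEuclideanLin M).singularValues_antitone
  have hrank : Module.finrank ℂ (Matrix.toEuclideanLin M).range = r := by
    rw [← hr, Matrix.rank_eq_finrank_range_toLin M (EuclideanSpace.basisFun _ ℂ).toBasis
      (EuclideanSpace.basisFun _ ℂ).toBasis, Matrix.toEuclideanLin_eq_toLin_orthonormal]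
  have hazero : ∀ k, r ≤ k → a k = 0 := by
    intro k hk
    exact (Matrix.toEuclideanLin M).singularValues_eq_zero_iff_le_finrank_range.2 (hrank ▸ hk)
  have hrm : r ≤ ∏ i, d i := by
    rw [← hr]
    refine M.rank_le_card_width.trans_eq ?_
    rw [Fintype.card_congr e, Fintype.card_fin]
  have htrace : traceNorm M = ∑ k, a (e k) := by
    rw [traceNorm, Fintype.card_congr e, Fintype.card_fin, e.sum_comp (fun k => a k),
      Finset.sum_range]
  -- the bound for one of the two families of singular vectors, written in a product basis
  have hhalf : ∀ W ∈ Matrix.unitaryGroup (∀ i, Fin (d i)) ℂ,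
      ∑ i, ∑ k, a (e k) * ∑ j, lam i (j i) * ‖W j k‖ ^ 2 ≤
        c * traceNorm M + N.kappa d r c * N.tensorNorm M := by
    intro W hW
    have hp := normSq_mem_doublyStochastic hW
    refine (sum_mul_sum_le_add (fun k => ha0 (e k)) hp c lam).trans ?_
    rw [htrace, hnorm]
    refine add_le_add le_rfl ((sum_mul_doublyStochastic_le e hanti _ hp).trans ?_)
    refine (N.sum_mul_le_dualGauge_mul hrm hazero _).trans ?_
    exact mul_le_mul_of_nonneg_right (le_csSup hbdd ⟨lam, hlam, hgauge, rfl⟩) (apply_nonneg _ _)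
  have hEV := hhalf _ (mul_mem (Unitary.star_mem (tensorProduct_mem_unitaryGroup hF)) hV)
  have hEU := hhalf _ (mul_mem (Unitary.star_mem (tensorProduct_mem_unitaryGroup hG)) hU)
  calc ∑ i, N.toSeminorm (d i) (partialTrace M i)
      ≤ ∑ i, (∑ k, a (e k) * ∑ j, lam i (j i) * ‖((tensorProduct F).conjTranspose * V) j k‖ ^ 2 +
          ∑ k, a (e k) *
            ∑ j, lam i (j i) * ‖((tensorProduct G).conjTranspose * U) j k‖ ^ 2) / 2 := by
        refine Finset.sum_le_sum fun i _ => ?_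
        have h := re_trace_partialTrace_mul_le (U := U) (V := V) (fun k => ha0 (e k)) hF hG i
          (hlam i)
        rw [← hM, hdual i, Complex.ofReal_re] at h
        exact h
    _ ≤ c * traceNorm M + N.kappa d r c * N.tensorNorm M := by
        rw [← Finset.sum_div, Finset.sum_add_distrib]
        simp only [Matrix.star_eq_conjTranspose] at hEV hEU
        linarith
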